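/- Let $\mathcal L$ be the propositional language over a countably infinite set $Pr$ of variables with binary connectives $\land,\lor,\to$ and unary $\neg,\Box,\Box_L$; $\varphi\leftrightarrow\psi$ abbreviates $(\varphi\to\psi)\land(\psi\to\varphi)$, and $p,q,r$ are distinct variables. The axiom system $\mathsf{BM.C}$ has the axioms $p\to p$; $\neg(p\land q)\to(\neg p\lor\neg q)$; $(\neg p\land\neg q)\to\neg(p\lor q)$; $(p\land q)\to p$; $(p\land q)\to q$; $p\to(p\lor q)$; $q\to(p\lor q)$; $((p\to q)\land(p\to r))\to(p\to(q\land r))$; $((p\to r)\land(q\to r))\to((p\lor q)\to r)$; $(p\land(q\lor r))\to((p\land q)\lor(p\land r))$; $(\Box p\land\Box q)\to\Box(p\land q)$; $(\Box_L p\land\Box_L q)\to\Box_L(p\land q)$, and the rules: uniform substitution; modus ponens; $\varphi,\psi\,/\,\varphi\land\psi$; $\varphi'\to\varphi,\ \psi\to\psi'\,/\,(\varphi\to\psi)\to(\varphi'\to\psi')$; $\varphi\to\psi\,/\,\neg\psi\to\neg\varphi$; $\varphi\to\psi\,/\,\Box_L\varphi\to\Box_L\psi$; $\varphi\to\psi\,/\,\Box\varphi\to\Box\psi$.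 Let $\mathsf L$ be any axiom system obtained from $\mathsf{BM.C}$ by adding an arbitrary selection of the following axioms and rules: (DN) $p\leftrightarrow\neg\neg p$; (Cp) $(p\to q)\to(\neg q\to\neg p)$; (WB) $((p\to q)\land(q\to r))\to(p\to r)$; (X) $p\lor\neg p$; (Rd) $(p\to\neg p)\to\neg p$; (B) $(p\to q)\to((r\to p)\to(r\to q))$; (CB) $(p\to q)\to((q\to r)\to(p\to r))$; (W) $(p\to(p\to q))\to(p\to q)$; (C) $(p\to(q\to r))\to(q\to(p\to r))$; (M) $p\to(p\to p)$; (ER) $\varphi\,/\,(\varphi\to\psi)\to\psi$; (Nec) $\varphi\,/\,\Box\varphi$; ($\Box$K) $\Box(p\to q)\to(\Box p\to\Box q)$; ($\Box$T) $\Box p\to p$; ($\Box$D) $\Box\neg p\to\neg\Box p$; ($\Box$4) $\Box p\to\Box\Box p$; ($\Box$5) $\neg\Box p\to\Box\neg\Box p$. Let $\mathsf{CL}$ be the axiom system consisting of (i) an axiomatization of classical propositional logic in $\land,\lor,\to,\neg$ with modus ponens and uniform substitution of arbitrary formulas of $\mathcal L$; (ii) the axiom $\Box_L\varphi$ for every axiom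 $\varphi$ of $\mathsf L$, and the rule $\Box_L\varphi_1,\ldots,\Box_L\varphi_n\,/\,\Box_L\psi$ for every inference rule $\varphi_1,\ldots,\varphi_n\,/\,\psi$ of $\mathsf L$; (iii) the Bridge Rule $\Box_L(\varphi\to\psi)\,/\,\varphi\to\psi$. Then for every such $\mathsf L$ and every formula $\varphi$ of $\mathcal L$: $\vdash_{\mathsf L}\varphi$ if and only if $\vdash_{\mathsf{CL}}\Box_L\varphi$. -/

import Mathlib

/-! Bimodal relevant logics and the classical modal logics built on them, as Hilbert systems. -/

namespace RelevantModal

/-- Formulas over the countable set `ℕ` of propositional variables. `box` is the epistemic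
modality `□`, and `boxL` is the auxiliary modality `□_L`. -/
inductive Fm : Type
  | var (n : ℕ) : Fm
  | and (φ ψ : Fm) : Fm
  | or (φ ψ : Fm) : Fm
  | imp (φ ψ : Fm) : Fm
  | neg (φ : Fm) : Fm
  | box (φ : Fm) : Fm
  | boxL (φ : Fm) : Fm

infixr:65 " ⋏ " => Fm.and
infixr:64 " ⋎ " => Fm.or
infixr:63 " ⇒ " => Fm.imp
prefix:max "∼" => Fm.neg
prefix:max "◻" => Fm.box
prefix:max "◻ₗ" => Fm.boxL

namespace Fm

/-- `φ ↔ ψ` abbreviates `(φ → ψ) ∧ (ψ → φ)`. -/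
def iff (φ ψ : Fm) : Fm := (φ ⇒ ψ) ⋏ (ψ ⇒ φ)

/-- The result of simultaneously replacing each variable `n` by the formula `σ n`. -/
def subst (σ : ℕ → Fm) : Fm → Fm
  | var n => σ n
  | and φ ψ => subst σ φ ⋏ subst σ ψ
  | or φ ψ => subst σ φ ⋎ subst σ ψ
  | imp φ ψ => subst σ φ ⇒ subst σ ψ
  | neg φ => ∼(subst σ φ)
  | box φ => ◻(subst σ φ)
  | boxL φ => ◻ₗ(subst σ φ)

/-- Three distinct propositional variables. -/
abbrev p : Fm := var 0
abbrev q : Fm := var 1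
abbrev r : Fm := var 2

end Fm

open Fm

/-- An axiom system: a set of axioms, and a set of inference steps (all the instances of its
inference rules); `rule Γ ψ` says that `ψ` may be inferred from the premises in the list `Γ`. -/
structure AxSystem : Type where
  ax : Fm → Prop
  rule : List Fm → Fm → Prop

/-- Provability in an axiom system. -/
inductive AxSystem.Provable (A : AxSystem) : Fm → Prop
  | ax {φ : Fm} : A.ax φ → A.Provable φ
  | rule {Γ : List Fm} {ψ : Fm} : A.rule Γ ψ → (∀ φ ∈ Γ, A.Provable φ) → A.Provable ψ

/-- Modus ponens. -/
inductive RuleMP : List Fm → Fm → Prop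
  | mk (φ ψ : Fm) : RuleMP [φ, φ ⇒ ψ] ψ

/-- Uniform substitution. -/
inductive RuleUS : List Fm → Fm → Prop
  | mk (φ : Fm) (σ : ℕ → Fm) : RuleUS [φ] (φ.subst σ)

/-- The axioms of `BM.C`. -/
inductive BMCAx : Fm → Prop
  | a1 : BMCAx (p ⇒ p)
  | a2 : BMCAx (∼(p ⋏ q) ⇒ (∼p ⋎ ∼q))
  | a3 : BMCAx ((∼p ⋏ ∼q) ⇒ ∼(p ⋎ q))
  | a4 : BMCAx ((p ⋏ q) ⇒ p)
  | a5 : BMCAx ((p ⋏ q) ⇒ q)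
  | a6 : BMCAx (p ⇒ (p ⋎ q))
  | a7 : BMCAx (q ⇒ (p ⋎ q))
  | a8 : BMCAx (((p ⇒ q) ⋏ (p ⇒ r)) ⇒ (p ⇒ (q ⋏ r)))
  | a9 : BMCAx (((p ⇒ r) ⋏ (q ⇒ r)) ⇒ ((p ⋎ q) ⇒ r))
  | a10 : BMCAx ((p ⋏ (q ⋎ r)) ⇒ ((p ⋏ q) ⋎ (p ⋏ r)))
  | a11 : BMCAx ((◻p ⋏ ◻q) ⇒ ◻(p ⋏ q))
  | a12 : BMCAx ((◻ₗp ⋏ ◻ₗq) ⇒ ◻ₗ(p ⋏ q))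

/-- The rules of `BM.C` other than uniform substitution and modus ponens. -/
inductive BMCRule : List Fm → Fm → Prop
  | adj (φ ψ : Fm) : BMCRule [φ, ψ] (φ ⋏ ψ)
  | aff (φ φ' ψ ψ' : Fm) : BMCRule [φ' ⇒ φ, ψ ⇒ ψ'] ((φ ⇒ ψ) ⇒ (φ' ⇒ ψ'))
  | con (φ ψ : Fm) : BMCRule [φ ⇒ ψ] (∼ψ ⇒ ∼φ)
  | boxL_mon (φ ψ : Fm) : BMCRule [φ ⇒ ψ] (◻ₗφ ⇒ ◻ₗψ)
  | box_mon (φ ψ : Fm) : BMCRule [φ ⇒ ψ] (◻φ ⇒ ◻ψ)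

/-- Names of the optional axioms and rules that may be added to `BM.C`. -/
inductive Ext : Type
  | DN | Cp | WB | X | Rd | B | CB | W | C | M | ER | Nec
  | boxK | boxT | boxD | box4 | box5

/-- The axiom that goes with a name (there is none for `ER` and `Nec`, which are rules). -/
inductive ExtAx : Ext → Fm → Prop
  | DN : ExtAx .DN (Fm.iff p ∼∼p)
  | Cp : ExtAx .Cp ((p ⇒ q) ⇒ (∼q ⇒ ∼p))
  | WB : ExtAx .WB (((p ⇒ q) ⋏ (q ⇒ r)) ⇒ (p ⇒ r))
  | X : ExtAx .X (p ⋎ ∼p)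
  | Rd : ExtAx .Rd ((p ⇒ ∼p) ⇒ ∼p)
  | B : ExtAx .B ((p ⇒ q) ⇒ ((r ⇒ p) ⇒ (r ⇒ q)))
  | CB : ExtAx .CB ((p ⇒ q) ⇒ ((q ⇒ r) ⇒ (p ⇒ r)))
  | W : ExtAx .W ((p ⇒ (p ⇒ q)) ⇒ (p ⇒ q))
  | C : ExtAx .C ((p ⇒ (q ⇒ r)) ⇒ (q ⇒ (p ⇒ r)))
  | M : ExtAx .M (p ⇒ (p ⇒ p))
  | boxK : ExtAx .boxK (◻(p ⇒ q) ⇒ (◻p ⇒ ◻q))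
  | boxT : ExtAx .boxT (◻p ⇒ p)
  | boxD : ExtAx .boxD (◻∼p ⇒ ∼◻p)
  | box4 : ExtAx .box4 (◻p ⇒ ◻◻p)
  | box5 : ExtAx .box5 (∼◻p ⇒ ◻∼◻p)

/-- The rule that goes with the names `ER` and `Nec`. -/
inductive ExtRule : Ext → List Fm → Fm → Prop
  | ER (φ ψ : Fm) : ExtRule .ER [φ] ((φ ⇒ ψ) ⇒ ψ)
  | Nec (φ : Fm) : ExtRule .Nec [φ] ◻φ

/-- The axiom system `L` of the relevant modal logic given by a selection `E`: `BM.C` together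
with the axioms and rules named in `E`. -/
def relevantSystem (E : Set Ext) : AxSystem where
  ax φ := BMCAx φ ∨ ∃ e ∈ E, ExtAx e φ
  rule Γ ψ := RuleUS Γ ψ ∨ RuleMP Γ ψ ∨ BMCRule Γ ψ ∨ ∃ e ∈ E, ExtRule e Γ ψ

/-- A standard (Kleene-style) axiomatization of classical propositional logic; its rules are
uniform substitution and modus ponens. -/
inductive CPCAx : Fm → Prop
  | imp_K : CPCAx (p ⇒ (q ⇒ p))
  | imp_S : CPCAx ((p ⇒ (q ⇒ r)) ⇒ ((p ⇒ q) ⇒ (p ⇒ r)))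
  | and_left : CPCAx ((p ⋏ q) ⇒ p)
  | and_right : CPCAx ((p ⋏ q) ⇒ q)
  | and_intro : CPCAx (p ⇒ (q ⇒ (p ⋏ q)))
  | or_left : CPCAx (p ⇒ (p ⋎ q))
  | or_right : CPCAx (q ⇒ (p ⋎ q))
  | or_elim : CPCAx ((p ⇒ r) ⇒ ((q ⇒ r) ⇒ ((p ⋎ q) ⇒ r)))
  | neg_intro : CPCAx ((p ⇒ q) ⇒ ((p ⇒ ∼q) ⇒ ∼p))
  | neg_elim : CPCAx (∼∼p ⇒ p)

/-- The Bridge Rule: from `□_L (φ → ψ)` infer `φ → ψ`. -/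
inductive RuleBR : List Fm → Fm → Prop
  | mk (φ ψ : Fm) : RuleBR [◻ₗ(φ ⇒ ψ)] (φ ⇒ ψ)

/-- The rules `□_L φ₁, …, □_L φₙ / □_L ψ` for the rules `φ₁, …, φₙ / ψ` of `A`. -/
inductive BoxedRule (A : AxSystem) : List Fm → Fm → Prop
  | mk {Γ : List Fm} {ψ : Fm} : A.rule Γ ψ → BoxedRule A (Γ.map Fm.boxL) ◻ₗψ

/-- The axiom system `CL` for an axiom system `L`: classical propositional logic with
substitution and modus ponens for the whole language, the `□_L`-versions of all axioms and
rules of `L`, and the Bridge Rule. -/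
def AxSystem.classical (L : AxSystem) : AxSystem where
  ax χ := CPCAx χ ∨ ∃ φ, L.ax φ ∧ χ = ◻ₗφ
  rule Γ ψ := RuleMP Γ ψ ∨ RuleUS Γ ψ ∨ BoxedRule L Γ ψ ∨ RuleBR Γ ψ

end RelevantModal

namespace RelevantModal

open Fm

/-! Left to right, a derivation in `L` is copied under `◻ₗ`. The converse is soundness for a
classical semantics that erases `◻` and reads `◻ₗφ` as `L`-provability of `φ.subst σ`. `L` is sound
for it (`eval_of_provable`), which validates the Bridge Rule, so `CL` is sound too
(`eval_of_classical_provable`). Taking `σ` to be the identity, validity of `◻ₗφ` is provability of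
`φ`. -/

theorem Fm.subst_subst (τ σ : ℕ → Fm) (φ : Fm) :
    (φ.subst τ).subst σ = φ.subst fun n => (τ n).subst σ := by
  induction φ <;> simp_all [Fm.subst]

theorem Fm.subst_var (φ : Fm) : φ.subst Fm.var = φ := by
  induction φ <;> simp_all [Fm.subst]

/-- The classical valuation over `a` in which `◻` is the identity and `◻ₗφ` says that `A` proves
the substitution instance of `φ` under `σ`. -/
def AxSystem.eval (A : AxSystem) (a : ℕ → Prop) (σ : ℕ → Fm) : Fm → Prop
  | .var n => a n
  | .and φ ψ => A.eval a σ φ ∧ A.eval a σ ψ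
  | .or φ ψ => A.eval a σ φ ∨ A.eval a σ ψ
  | .imp φ ψ => A.eval a σ φ → A.eval a σ ψ
  | .neg φ => ¬ A.eval a σ φ
  | .box φ => A.eval a σ φ
  | .boxL φ => A.Provable (φ.subst σ)

/-- A substitution alters both the truth values of variables and the formulas put for them under
`◻ₗ`. Validity must therefore range over all `a` and `σ` to be closed under uniform substitution. -/
theorem AxSystem.eval_subst (A : AxSystem) (a : ℕ → Prop) (σ τ : ℕ → Fm) (φ : Fm) :
    A.eval a σ (φ.subst τ) ↔
      A.eval (fun n => A.eval a σ (τ n)) (fun n => (τ n).subst σ) φ := by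
  induction φ <;> simp_all [Fm.subst, AxSystem.eval, Fm.subst_subst]

section Relevant

variable {E : Set Ext}

theorem relevantSystem_subst {φ : Fm} (h : (relevantSystem E).Provable φ) (σ : ℕ → Fm) :
    (relevantSystem E).Provable (φ.subst σ) :=
  .rule (Or.inl (RuleUS.mk φ σ)) (by simpa using h)

theorem relevantSystem_mp {φ ψ : Fm} (h : (relevantSystem E).Provable φ)
    (hi : (relevantSystem E).Provable (φ ⇒ ψ)) : (relevantSystem E).Provable ψ :=
  .rule (Or.inr (Or.inl (RuleMP.mk φ ψ))) (by simpa using ⟨h, hi⟩)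

theorem relevantSystem_adj {φ ψ : Fm} (h : (relevantSystem E).Provable φ)
    (h' : (relevantSystem E).Provable ψ) : (relevantSystem E).Provable (φ ⋏ ψ) :=
  .rule (Or.inr (Or.inr (Or.inl (BMCRule.adj φ ψ)))) (by simpa using ⟨h, h'⟩)

theorem eval_of_BMCAx {φ : Fm} (h : BMCAx φ) (a : ℕ → Prop) (σ : ℕ → Fm) :
    (relevantSystem E).eval a σ φ := by
  cases h
  case a12 => exact fun h => relevantSystem_adj h.1 h.2
  all_goals simp only [AxSystem.eval]; tauto

/-- None of these axioms mentions `◻ₗ`, and each is a classical tautology once `◻` is erased, so `A`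
may be arbitrary. -/
theorem eval_of_ExtAx (A : AxSystem) {e : Ext} {φ : Fm} (h : ExtAx e φ) (a : ℕ → Prop)
    (σ : ℕ → Fm) : A.eval a σ φ := by
  cases h <;> simp only [AxSystem.eval, Fm.iff] <;> tauto

theorem eval_of_CPCAx (A : AxSystem) {φ : Fm} (h : CPCAx φ) (a : ℕ → Prop)
    (σ : ℕ → Fm) : A.eval a σ φ := by
  cases h <;> simp only [AxSystem.eval] <;> tauto

/-- Every theorem of a relevant system holds under all valuations. -/
theorem eval_of_provable {φ : Fm} (h : (relevantSystem E).Provable φ) :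
    ∀ a σ, (relevantSystem E).eval a σ φ := by
  induction h with
  | ax h =>
    intro a σ
    rcases h with h | ⟨e, -, h⟩
    · exact eval_of_BMCAx h a σ
    · exact eval_of_ExtAx _ h a σ
  | rule hr hp ih =>
    intro a σ
    rcases hr with ⟨φ, τ⟩ | ⟨φ, _⟩ | hr | ⟨e, -, hr⟩
    · exact ((relevantSystem E).eval_subst a σ τ φ).2 (ih φ (by simp) _ _)
    · exact ih (φ ⇒ _) (by simp) a σ (ih φ (by simp) a σ)
    · cases hr with
      | boxL_mon φ ψ =>
        -- Truth of the premise is not enough here: its provability `hp` is needed, as `◻ₗ` is read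
        -- as provability.
        exact fun h => relevantSystem_mp h (relevantSystem_subst (hp (φ ⇒ ψ) (by simp)) σ)
      | _ =>
        simp only [List.mem_cons, List.not_mem_nil, or_false, forall_eq_or_imp, forall_eq,
          AxSystem.eval] at ih ⊢
        grind
    · cases hr with
      | ER φ ψ => exact fun h => h (ih φ (by simp) a σ)
      | Nec φ => exact ih φ (by simp) a σ

/-- Every theorem of the classical system over a relevant system holds under all valuations. -/
theorem eval_of_classical_provable {χ : Fm} (h : (relevantSystem E).classical.Provable χ) :
    ∀ a σ, (relevantSystem E).eval a σ χ := by
  have provable_of_eval {φ : Fm} (h : ∀ a σ, (relevantSystem E).eval a σ ◻ₗφ) :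
      (relevantSystem E).Provable φ := by
    simpa only [AxSystem.eval, Fm.subst_var] using h (fun _ => True) Fm.var
  induction h with
  | ax h =>
    intro a σ
    rcases h with h | ⟨φ, h, rfl⟩
    · exact eval_of_CPCAx _ h a σ
    · exact relevantSystem_subst (.ax h) σ
  | rule hr hp ih =>
    intro a σ
    rcases hr with ⟨φ, _⟩ | ⟨φ, τ⟩ | hr | ⟨φ, ψ⟩
    · exact ih (φ ⇒ _) (by simp) a σ (ih φ (by simp) a σ)
    · exact ((relevantSystem E).eval_subst a σ τ φ).2 (ih φ (by simp) _ _)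
    · obtain ⟨hr⟩ := hr
      exact relevantSystem_subst
        (.rule hr fun φ hφ => provable_of_eval (ih ◻ₗφ (List.mem_map_of_mem hφ))) σ
    -- Bridge Rule: validity of the boxed premise yields an `L`-proof, to which soundness of `L`
    -- applies.
    · exact eval_of_provable (provable_of_eval (ih ◻ₗ(φ ⇒ ψ) (by simp))) a σ

end Relevant

theorem AxSystem.Provable.classical_boxL {A : AxSystem} {φ : Fm} (h : A.Provable φ) :
    A.classical.Provable ◻ₗφ := by
  induction h with
  | ax h => exact .ax (Or.inr ⟨_, h, rfl⟩)
  | rule hr _ ih =>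
    refine .rule (Or.inr (Or.inr (Or.inl (BoxedRule.mk hr)))) fun χ hχ => ?_
    obtain ⟨φ, hφ, rfl⟩ := List.mem_map.1 hχ
    exact ih φ hφ

end RelevantModal

theorem mainTheorem2 (E : Set RelevantModal.Ext) (φ : RelevantModal.Fm) :
    (RelevantModal.relevantSystem E).Provable φ ↔
      (RelevantModal.relevantSystem E).classical.Provable (RelevantModal.Fm.boxL φ) := by
  refine ⟨fun h => h.classical_boxL, fun h => ?_⟩
  simpa only [RelevantModal.AxSystem.eval, RelevantModal.Fm.subst_var] using
    RelevantModal.eval_of_classical_provable h (fun _ => True) RelevantModal.Fm.var
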